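/- A permutation $\pi$ contains a permutation $\sigma$ if some subsequence of $\pi$ (in one-line notation) is order isomorphic to $\sigma$. A permutation class is a set $\mathcal{C}$ of finite permutations closed downward under containment; it is well-quasi-ordered (wqo) if it contains no infinite antichain. Writing $|\mathcal{C}_n|$ for the number of permutations of length $n$ in $\mathcal{C}$, its enumeration sequence is $(|\mathcal{C}_n|)_{n\ge 0}$ and its generating function is $f(x)=\sum_{n\ge 0}|\mathcal{C}_n|x^n$. The series $f$ is algebraic if $p(x,f(x))=0$ for some nonzero $p\in\mathbb{Q}[x,y]$, and D-finite if $f$ and all its derivatives span a finite-dimensional vector space over $\mathbb{Q}(x)$. A class is strongly algebraic if it and all of its subclasses have algebraic generating functions. Theorem 1.1. There are uncountably many distinct enumeration sequences of wqo permutation classes. Consequently: 1. there is a wqo permutation class whose generating function is not algebraic; 2. there is a wqo permutation class whose generating function is not D-finite; 3. it is not true that a permutation class is strongly algebraic if and only if it is wqo (so Vatter's conjecture is false). -/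

import Mathlib

open scoped Polynomial PowerSeries LaurentSeries

/-- A (finite) permutation in one-line notation `perm 0, perm 1, …, perm (length - 1)`
(with values `0, …, length - 1` in place of `1, …, length`). -/
structure Permutation where
  length : ℕ
  perm : Equiv.Perm (Fin length)

namespace Permutation

/-- The containment order: `σ ≤ π` if some subsequence of `π` (given by a strictly increasing
choice `f` of positions) is order isomorphic to `σ`. -/
instance : LE Permutation where
  le σ π := ∃ f : Fin σ.length → Fin π.length, StrictMono f ∧
    ∀ i j, σ.perm i < σ.perm j ↔ π.perm (f i) < π.perm (f j)

end Permutation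

/-- A permutation class: a downset in the containment order. -/
abbrev PermutationClass : Type := LowerSet Permutation

namespace PermutationClass

/-- A permutation class is well-quasi-ordered if it contains no infinite antichain. -/
def IsWQO (C : PermutationClass) : Prop :=
  ∀ A : Set Permutation, A ⊆ (C : Set Permutation) → IsAntichain (· ≤ ·) A → A.Finite

/-- The enumeration sequence of a class: the number of its members of each length `n ≥ 0`. -/
noncomputable def enumeration (C : PermutationClass) (n : ℕ) : ℕ :=
  Nat.card {π : Equiv.Perm (Fin n) // (⟨n, π⟩ : Permutation) ∈ C}

/-- The generating function `∑ |Cₙ| xⁿ`, a formal power series with rational coefficients. -/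
noncomputable def genFun (C : PermutationClass) : ℚ⟦X⟧ :=
  PowerSeries.mk fun n => (C.enumeration n : ℚ)

end PermutationClass

/-- `f` is algebraic: `p(x, f(x)) = 0` for some nonzero `p(x, y) ∈ ℚ[x][y]`. -/
def IsAlgebraicSeries (f : ℚ⟦X⟧) : Prop := IsAlgebraic ℚ[X] f

section
open scoped RatFunc

/-- `f` is D-finite: `f` and all its derivatives span a finite-dimensional vector space over the
field `ℚ(x)` of rational functions, inside the field of formal Laurent series. -/
def IsDFinite (f : ℚ⟦X⟧) : Prop :=
  FiniteDimensional (RatFunc ℚ) (Submodule.span (RatFunc ℚ)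
    (Set.range fun k : ℕ => (((PowerSeries.derivative ℚ)^[k] f : ℚ⟦X⟧) : ℚ⸨X⸩)))

end

/-- A class is strongly algebraic if it and all its subclasses have algebraic generating
functions. -/
def PermutationClass.IsStronglyAlgebraic (C : PermutationClass) : Prop :=
  ∀ D : PermutationClass, D ≤ C → IsAlgebraicSeries D.genFun

/-! A binary word `s` is coded by an infinite pin sequence whose successive pairs of points lie
above or below an axis as `s` prescribes; `pinClass s` collects the permutations found in it. The
relative position of two points depends only on their types and on whether their indices are
adjacent. A finite set of points is therefore a list of separated blocks, and embedding blocks into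
blocks in order gives containment. If `s` is uniformly recurrent, blocks are wqo under occurrence,
and Higman's lemma makes the class wqo (`isWQO_pinClass`).

Toeplitz words supply uncountably many such `s`. Let `t` and `t'` first differ at `k > 0`, with `t
k` true. Their words agree off the holes of level `k`; adjacent holes carry all four pairs of
letters in the word of `t`, but never `11` in that of `t'`. So among windows meeting at most two
holes, the word of `t` has all those of `t'` and at least one more. A long run of pins determines
the interior of its window of the word, so at some length the class of `t` is strictly larger
(`enumeration_pinClass_toeplitz_ne`).

Only countably many series over `ℚ` are algebraic or D-finite, so some class escapes each family. -/

/-! ### Toeplitz words -/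

/-- The Toeplitz word of period pattern `0 0 1 (t 0) *`, whose holes `*` are filled by the Toeplitz
word of the shifted sequence `t 1, t 2, …`. -/
def toeplitz (t : ℕ → Bool) (n : ℕ) : Bool :=
  if n % 5 = 4 then toeplitz (fun i => t (i + 1)) (n / 5)
  else if n % 5 = 3 then t 0
  else decide (n % 5 = 2)
termination_by n
decreasing_by omega

theorem toeplitz_of_mod_four {t : ℕ → Bool} {n : ℕ} (h : n % 5 = 4) :
    toeplitz t n = toeplitz (fun i => t (i + 1)) (n / 5) := by
  rw [toeplitz, if_pos h]

theorem toeplitz_of_mod_three {t : ℕ → Bool} {n : ℕ} (h : n % 5 = 3) : toeplitz t n = t 0 := by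
  rw [toeplitz, if_neg (by omega), if_pos h]

theorem toeplitz_of_mod_two {t : ℕ → Bool} {n : ℕ} (h : n % 5 = 2) : toeplitz t n = true := by
  rw [toeplitz, if_neg (by omega), if_neg (by omega)]
  simpa using h

theorem toeplitz_of_mod_lt_two {t : ℕ → Bool} {n : ℕ} (h : n % 5 < 2) :
    toeplitz t n = false := by
  rw [toeplitz, if_neg (by omega), if_neg (by omega)]
  simp; omega

/-- Away from the holes of level `k`, the word is periodic with period `5 ^ k` and depends on the
first `k` terms of the sequence only. -/
theorem toeplitz_congr (k : ℕ) {t t' : ℕ → Bool} (ht : ∀ i < k, t i = t' i) {m n : ℕ}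
    (hmn : m % 5 ^ k = n % 5 ^ k) (hm : ¬ 5 ^ k ∣ m + 1) : toeplitz t m = toeplitz t' n := by
  induction k generalizing t t' m n with
  | zero => simp at hm
  | succ k ih =>
    have h5 : m % 5 = n % 5 := by
      have := congrArg (· % 5) hmn
      simpa [pow_succ, Nat.mod_mul_left_mod] using this
    rcases (by omega : m % 5 < 2 ∨ m % 5 = 2 ∨ m % 5 = 3 ∨ m % 5 = 4) with h | h | h | h
    · rw [toeplitz_of_mod_lt_two h, toeplitz_of_mod_lt_two (by omega)]
    · rw [toeplitz_of_mod_two h, toeplitz_of_mod_two (by omega)]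
    · rw [toeplitz_of_mod_three h, toeplitz_of_mod_three (by omega), ht 0 (by omega)]
    · have hn : n % 5 = 4 := by omega
      rw [toeplitz_of_mod_four h, toeplitz_of_mod_four hn]
      refine ih (fun i hi => ht (i + 1) (by omega)) ?_ ?_
      · rw [pow_succ', Nat.mod_mul, Nat.mod_mul] at hmn
        omega
      · rintro ⟨c, hc⟩
        refine hm ⟨c, ?_⟩
        rw [pow_succ', mul_assoc, ← hc]
        omega

/-- The letters in the holes of level `k`. -/
theorem toeplitz_hole (k : ℕ) (t : ℕ → Bool) {m j : ℕ} (h : m + 1 = 5 ^ k * (j + 1)) :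
    toeplitz t m = toeplitz (fun i => t (i + k)) j := by
  induction k generalizing t m with
  | zero => simp at h; simp [h]
  | succ k ih =>
    rw [pow_succ', mul_assoc] at h
    rw [toeplitz_of_mod_four (by omega), ih (fun i => t (i + 1)) (m := m / 5) (by omega)]
    congr 1

/-- Every finite window of `w` recurs with bounded gaps. -/
def UniformlyRecurrent {α : Type*} (w : ℕ → α) : Prop :=
  ∀ a n, ∃ R, ∀ b, ∃ d, b ≤ d ∧ d + n ≤ b + R ∧ ∀ e < n, w (d + e) = w (a + e)

/-- The first hole of level `k = a + n` is at `5 ^ k - 1`, beyond the window, so the window lies in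
the part of the word with period `5 ^ k`. -/
theorem uniformlyRecurrent_toeplitz (t : ℕ → Bool) : UniformlyRecurrent (toeplitz t) := by
  intro a n
  have hk : a + n < 5 ^ (a + n) := Nat.lt_pow_self (by norm_num)
  have hpos : 0 < 5 ^ (a + n) := by positivity
  refine ⟨a + n + 5 ^ (a + n), fun b => ⟨a + 5 ^ (a + n) * (b / 5 ^ (a + n) + 1), ?_, ?_, ?_⟩⟩
  · have := Nat.lt_mul_div_succ b hpos
    omega
  · have := Nat.mul_div_le b (5 ^ (a + n))
    rw [mul_add]
    omega
  · intro e he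
    refine toeplitz_congr (a + n) (fun _ _ => rfl) ?_ fun hdvd => ?_
    · rw [add_right_comm, Nat.add_mul_mod_self_left]
    · rw [add_right_comm a, add_right_comm (a + e), Nat.dvd_add_left (dvd_mul_right _ _)] at hdvd
      have := Nat.le_of_dvd (by omega) hdvd
      omega

/-- Windows of length at least `5 ^ k` determine their position modulo `5 ^ k`. -/
theorem toeplitz_sync (k : ℕ) {t t' : ℕ → Bool} {a b : ℕ}
    (h : ∀ e < 5 ^ k, toeplitz t (a + e) = toeplitz t' (b + e)) : a % 5 ^ k = b % 5 ^ k := by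
  induction k generalizing t t' a b with
  | zero => simp [Nat.mod_one]
  | succ k ih =>
    have hpos : 0 < 5 ^ k := by positivity
    rw [pow_succ'] at h
    have h5 : a % 5 = b % 5 := by
      -- Residue 2 always carries 1, residues 0 and 1 always carry 0. If the residues of `a` and `b`
      -- differ, moving one of them to residue 2 moves the other to 0 or 1.
      by_contra hne
      rcases (by omega : (b + (7 - a % 5) % 5) % 5 < 2 ∨ (a + (7 - b % 5) % 5) % 5 < 2) with h2 | h2
      · have := h ((7 - a % 5) % 5) (by omega)
        rw [toeplitz_of_mod_two (by omega), toeplitz_of_mod_lt_two h2] at this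
        simp at this
      · have := h ((7 - b % 5) % 5) (by omega)
        rw [toeplitz_of_mod_lt_two h2, toeplitz_of_mod_two (by omega)] at this
        simp at this
    -- The letters in the holes form windows of the shifted words, of length `5 ^ k`.
    have := ih (t := fun i => t (i + 1)) (t' := fun i => t' (i + 1)) (a := a / 5) (b := b / 5) (by
      intro e he
      have := h (4 - a % 5 + 5 * e) (by omega)
      rwa [toeplitz_of_mod_four (n := a + _) (by omega),
        toeplitz_of_mod_four (n := b + _) (by omega),
        show (a + (4 - a % 5 + 5 * e)) / 5 = a / 5 + e by omega,
        show (b + (4 - a % 5 + 5 * e)) / 5 = b / 5 + e by omega] at this)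
    rw [pow_succ', Nat.mod_mul, Nat.mod_mul, h5, this]

/-- The pattern `0 0 1 1 *` shows 00, 01 and 11; the pair 10 comes from a hole filled with 1,
followed by the 0 of the next period. With pattern `0 0 1 0 *` instead, every 1 has only 0 beside
it, which excludes 11. -/
theorem exists_toeplitz_pair {t : ℕ → Bool} (ht : t 0 = true) (x y : Bool) (N : ℕ) :
    ∃ j ≥ N, toeplitz t j = x ∧ toeplitz t (j + 1) = y := by
  cases x <;> cases y
  · exact ⟨5 * N, by omega, toeplitz_of_mod_lt_two (by omega), toeplitz_of_mod_lt_two (by omega)⟩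
  · exact ⟨5 * N + 1, by omega, toeplitz_of_mod_lt_two (by omega), toeplitz_of_mod_two (by omega)⟩
  · refine ⟨5 * (5 * N + 2) + 4, by omega, ?_, toeplitz_of_mod_lt_two (by omega)⟩
    rw [toeplitz_of_mod_four (by omega), toeplitz_of_mod_two (by omega)]
  · exact ⟨5 * N + 2, by omega, toeplitz_of_mod_two (by omega),
      by rw [toeplitz_of_mod_three (by omega), ht]⟩

theorem toeplitz_not_pair {t : ℕ → Bool} (ht : t 0 = false) (j : ℕ) :
    ¬ (toeplitz t j = true ∧ toeplitz t (j + 1) = true) := by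
  rintro ⟨h1, h2⟩
  rcases (by omega : j % 5 < 2 ∨ j % 5 = 2 ∨ j % 5 = 3 ∨ (j + 1) % 5 < 2) with h | h | h | h
  · simp [toeplitz_of_mod_lt_two h] at h1
  · simp [toeplitz_of_mod_three (show (j + 1) % 5 = 3 by omega), ht] at h2
  · simp [toeplitz_of_mod_three h, ht] at h1
  · simp [toeplitz_of_mod_lt_two h] at h2


/-! ### Comparing the windows of two Toeplitz words -/

/-- If `t` and `t'` agree below `k` and `t k = 1`, then all short windows of the word of `t'` occur
arbitrarily far out in that of `t`. -/
theorem exists_toeplitz_window {k : ℕ} {t t' : ℕ → Bool} (htt' : ∀ i < k, t i = t' i)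
    (hk : t k = true) {a n : ℕ} (hn : n ≤ 2 * 5 ^ k) (N : ℕ) :
    ∃ d ≥ N, ∀ e < n, toeplitz t (d + e) = toeplitz t' (a + e) := by
  have hpos : 0 < 5 ^ k := by positivity
  set q := 5 ^ k with hq
  obtain ⟨j, hj, h1, h2⟩ := exists_toeplitz_pair (t := fun i => t (i + k)) (by simpa using hk)
    (toeplitz (fun i => t' (i + k)) (a / q)) (toeplitz (fun i => t' (i + k)) (a / q + 1))
    (a / q + N)
  obtain ⟨r, rfl⟩ : ∃ r, j = a / q + r := ⟨j - a / q, by omega⟩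
  -- Shifting by a multiple of `q` keeps the letters off the holes. At most two holes, numbers `a /
  -- q` and `a / q + 1`, meet the window; they move to `j` and `j + 1`, where the letters are right
  -- by choice of `j`.
  refine ⟨a + q * r, ?_, fun e he => ?_⟩
  · have : r ≤ q * r := Nat.le_mul_of_pos_left _ hpos
    omega
  by_cases hdvd : q ∣ a + e + 1
  · obtain ⟨c, hc⟩ := hdvd
    have ha := Nat.div_add_mod a q
    have hlt := Nat.mod_lt a hpos
    have hc1 : a / q < c := by
      by_contra hle
      have := Nat.mul_le_mul_left q (not_lt.mp hle)
      omega
    have hc2 : c < a / q + 3 := by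
      by_contra hle
      have := Nat.mul_le_mul_left q (not_lt.mp hle)
      rw [mul_add] at this
      omega
    obtain rfl | rfl : c = a / q + 1 ∨ c = a / q + 1 + 1 := by omega
    · rw [toeplitz_hole k t' hc, ← h1]
      refine toeplitz_hole k t ?_
      rw [add_right_comm a, add_right_comm (a + e), hc]
      ring
    · rw [toeplitz_hole k t' hc, ← h2]
      refine toeplitz_hole k t ?_
      rw [add_right_comm a, add_right_comm (a + e), hc]
      ring
  · refine (toeplitz_congr k (fun i hi => (htt' i hi).symm) ?_ hdvd).symm
    rw [add_right_comm, Nat.add_mul_mod_self_left]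

/-- If `t` and `t'` agree below `k`, but `t k = 1` and `t' k = 0`, then the word of `t` has a window
of length `5 ^ k + 1` that does not occur in the word of `t'`. -/
theorem toeplitz_window_ne {k : ℕ} {t t' : ℕ → Bool} (hk : t k = true) (hk' : t' k = false)
    (b : ℕ) : ¬ ∀ e < 5 ^ k + 1, toeplitz t' (b + e) = toeplitz t (5 ^ k * 3 - 1 + e) := by
  intro h
  have hpos : 0 < 5 ^ k := by positivity
  have hmod := toeplitz_sync k (t := t') (t' := t) (a := b) (b := 5 ^ k * 3 - 1)
    fun e he => h e (by omega)
  obtain ⟨c, hc⟩ : 5 ^ k ∣ b + 1 := by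
    have h3 : 5 ^ k ∣ (5 ^ k * 3 - 1) + 1 := ⟨3, by omega⟩
    exact (Nat.ModEq.dvd_iff (Nat.ModEq.add_right 1 hmod) dvd_rfl).mpr h3
  obtain ⟨j, rfl⟩ : ∃ j, c = j + 1 := ⟨c - 1, by rcases c with _ | c <;> simp at hc ⊢⟩
  refine toeplitz_not_pair (t := fun i => t' (i + k)) (by simpa using hk') j ⟨?_, ?_⟩
  -- The two ends of the window are the holes numbered 2 and 3 of the word of `t`. Their letters are
  -- the fixed 1 of the pattern and `t k`, so 11 would occur in the holes of the word of `t'`.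
  · rw [← toeplitz_hole k t' hc]
    refine (h 0 (by omega)).trans ?_
    rw [toeplitz_hole k t (j := 2) (by omega), toeplitz_of_mod_two (by norm_num)]
  · rw [← toeplitz_hole k t' (m := b + 5 ^ k) (by rw [mul_add, ← hc]; ring), h _ (by omega),
      toeplitz_hole k t (j := 3) (by omega), toeplitz_of_mod_three (by norm_num)]
    simpa using hk

/-! ### Pin sequences and their classes -/

/-- Abscissa of the `i`-th point of a pin sequence. -/
def pinX (i : ℕ) : ℕ := if i % 2 = 0 then i else i + 2

/-- Absolute value of the ordinate of the `i`-th point of a pin sequence. -/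
def pinHeight (i : ℕ) : ℕ := if i % 2 = 0 then i + 2 else i

/-- Ordinate of the `i`-th point of the pin sequence whose `k`-th pair of points lies above the axis
if `s k` is true and below it otherwise. -/
def pinY (s : ℕ → Bool) (i : ℕ) : ℤ := if s (i / 2) then pinHeight i else -pinHeight i

/-- The data of a point that determines its position relative to earlier points. -/
def pinType (s : ℕ → Bool) (i : ℕ) : Bool × Bool := (decide (i % 2 = 0), s (i / 2))

theorem pinX_injective : Function.Injective pinX := by
  intro i j h
  unfold pinX at h
  split_ifs at h <;> omega

theorem pinY_injective (s : ℕ → Bool) : Function.Injective (pinY s) := by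
  intro i j h
  unfold pinY pinHeight at h
  split_ifs at h <;> omega

theorem pinType_eq_iff {s s' : ℕ → Bool} {i j : ℕ} :
    pinType s i = pinType s' j ↔ i % 2 = j % 2 ∧ s (i / 2) = s' (j / 2) := by
  simp only [pinType, Prod.mk.injEq, decide_eq_decide, and_congr_left_iff]
  omega

/-- A later point lies further right and further from the axis, with two exceptions: an odd point is
to the right of its successor, and an even point is further out than its successor, which is on the
same side. So types and adjacency settle both comparisons. -/
theorem pin_lt_iff_of_lt {s s' : ℕ → Bool} {i j i' j' : ℕ} (hi : pinType s i = pinType s' i')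
    (hj : pinType s j = pinType s' j') (hij : i < j) (hij' : i' < j')
    (h : i + 1 = j ↔ i' + 1 = j') :
    (pinX i < pinX j ↔ pinX i' < pinX j') ∧ (pinX j < pinX i ↔ pinX j' < pinX i') ∧
      (pinY s i < pinY s j ↔ pinY s' i' < pinY s' j') ∧
      (pinY s j < pinY s i ↔ pinY s' j' < pinY s' i') := by
  rw [pinType_eq_iff] at hi hj
  unfold pinY
  rw [hi.2, hj.2]
  unfold pinX pinHeight
  refine ⟨?_, ?_, ?_, ?_⟩ <;> split_ifs <;> omega

/-- A map from a set of points of the pin sequence of `s` to the points of that of `s'` that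
preserves all relative positions. -/
structure IsPinEmbedding (s s' : ℕ → Bool) (S : Set ℕ) (g : ℕ → ℕ) : Prop where
  pinType_eq : ∀ i ∈ S, pinType s' (g i) = pinType s i
  lt : ∀ i ∈ S, ∀ j ∈ S, i < j → g i < g j
  succ_iff : ∀ i ∈ S, ∀ j ∈ S, i < j → (i + 1 = j ↔ g i + 1 = g j)

theorem IsPinEmbedding.lt_iff {s s' : ℕ → Bool} {S : Set ℕ} {g : ℕ → ℕ}
    (hg : IsPinEmbedding s s' S g) {i j : ℕ} (hi : i ∈ S) (hj : j ∈ S) :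
    (pinX i < pinX j ↔ pinX (g i) < pinX (g j)) ∧
      (pinY s i < pinY s j ↔ pinY s' (g i) < pinY s' (g j)) := by
  have hti := (hg.pinType_eq i hi).symm
  have htj := (hg.pinType_eq j hj).symm
  rcases lt_trichotomy i j with h | rfl | h
  · have := pin_lt_iff_of_lt hti htj h (hg.lt i hi j hj h) (hg.succ_iff i hi j hj h)
    tauto
  · simp
  · have := pin_lt_iff_of_lt htj hti h (hg.lt j hj i hi h) (hg.succ_iff j hj i hi h)
    tauto

/-- The points `p 0, p 1, …` of the pin sequence of `s` form a copy of `σ`. -/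
def PinRealizes (s : ℕ → Bool) (σ : Permutation) (p : Fin σ.length → ℕ) : Prop :=
  ∀ i j, (i < j ↔ pinX (p i) < pinX (p j)) ∧
    (σ.perm i < σ.perm j ↔ pinY s (p i) < pinY s (p j))

theorem PinRealizes.comp {s s' : ℕ → Bool} {σ : Permutation} {p : Fin σ.length → ℕ}
    (hp : PinRealizes s σ p) {S : Set ℕ} {g : ℕ → ℕ} (hg : IsPinEmbedding s s' S g)
    (hS : ∀ i, p i ∈ S) : PinRealizes s' σ (g ∘ p) := fun i j =>
  ⟨(hp i j).1.trans (hg.lt_iff (hS i) (hS j)).1, (hp i j).2.trans (hg.lt_iff (hS i) (hS j)).2⟩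

theorem PinRealizes.le {s : ℕ → Bool} {σ π : Permutation} {p : Fin σ.length → ℕ}
    {q : Fin π.length → ℕ} (hp : PinRealizes s σ p) (hq : PinRealizes s π q)
    (h : ∀ i, p i ∈ Set.range q) : σ ≤ π := by
  choose f hf using h
  refine ⟨f, fun i j hij => ?_, fun i j => ?_⟩
  · rw [(hq _ _).1, hf, hf]
    exact (hp i j).1.mp hij
  · rw [(hq _ _).2, hf, hf]
    exact (hp i j).2

/-- The class of all permutations contained in the pin sequence of `s`. -/
def pinClass (s : ℕ → Bool) : PermutationClass where
  carrier := {σ | ∃ p, PinRealizes s σ p}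
  lower' := by
    rintro π σ ⟨f, hf, hfσ⟩ ⟨p, hp⟩
    exact ⟨p ∘ f, fun i j => ⟨hf.lt_iff_lt.symm.trans (hp _ _).1, (hfσ i j).trans (hp _ _).2⟩⟩

theorem mem_pinClass {s : ℕ → Bool} {σ : Permutation} :
    σ ∈ pinClass s ↔ ∃ p, PinRealizes s σ p := Iff.rfl

/-- Every finite set of points of a pin sequence forms a copy of some permutation. -/
theorem exists_pinRealizes (s : ℕ → Bool) (S : Finset ℕ) :
    ∃ (σ : Equiv.Perm (Fin S.card)) (p : Fin S.card → ℕ),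
      PinRealizes s ⟨S.card, σ⟩ p ∧ Set.range p = S := by
  have hX : (S.image pinX).card = S.card := Finset.card_image_of_injective _ pinX_injective
  have hY : (S.image (pinY s)).card = S.card :=
    Finset.card_image_of_injective _ (pinY_injective s)
  let eX := (S.image pinX).orderIsoOfFin hX
  let eY := (S.image (pinY s)).orderIsoOfFin hY
  have hp (i : Fin S.card) : ∃ a ∈ S, pinX a = eX i := Finset.mem_image.mp (eX i).2
  choose p hpS hp using hp
  let f (i : Fin S.card) : Fin S.card := eY.symm ⟨pinY s (p i), Finset.mem_image_of_mem _ (hpS i)⟩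
  have hpinj : Function.Injective p := fun i j h => by
    have := (hp i).symm.trans ((congrArg pinX h).trans (hp j))
    exact eX.injective (Subtype.ext this)
  have hf : Function.Injective f := fun i j h => by
    have := Subtype.ext_iff.mp (eY.symm.injective h)
    exact hpinj (pinY_injective s this)
  refine ⟨Equiv.ofBijective f (Finite.injective_iff_bijective.mp hf), p, fun i j => ⟨?_, ?_⟩, ?_⟩
  · rw [hp, hp, Subtype.coe_lt_coe, eX.lt_iff_lt]
  · change f i < f j ↔ _
    rw [eY.symm.lt_iff_lt, Subtype.mk_lt_mk]
  · apply Set.Subset.antisymm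
    · rintro _ ⟨i, rfl⟩
      exact hpS i
    · intro a ha
      refine ⟨eX.symm ⟨pinX a, Finset.mem_image_of_mem _ ha⟩, pinX_injective ?_⟩
      rw [hp, OrderIso.apply_symm_apply]

/-! ### Blocks -/

/-- The union of a list of intervals of natural numbers, each given by its first element and its
length. -/
def blocksUnion (L : List (ℕ × ℕ)) : Set ℕ := {i | ∃ b ∈ L, b.1 ≤ i ∧ i < b.1 + b.2}

/-- The intervals are nonempty and listed in descending order, with gaps between them. -/
def BlocksSeparated (L : List (ℕ × ℕ)) : Prop :=
  (∀ b ∈ L, 0 < b.2) ∧ L.Pairwise fun b c => c.1 + c.2 < b.1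

theorem mem_blocksUnion_cons {b : ℕ × ℕ} {L : List (ℕ × ℕ)} {i : ℕ} :
    i ∈ blocksUnion (b :: L) ↔ (b.1 ≤ i ∧ i < b.1 + b.2) ∨ i ∈ blocksUnion L := by
  simp [blocksUnion]

theorem BlocksSeparated.tail {b : ℕ × ℕ} {L : List (ℕ × ℕ)} (h : BlocksSeparated (b :: L)) :
    BlocksSeparated L :=
  ⟨fun c hc => h.1 c (List.mem_cons_of_mem _ hc), (List.pairwise_cons.mp h.2).2⟩

theorem BlocksSeparated.lt {b : ℕ × ℕ} {L : List (ℕ × ℕ)} (h : BlocksSeparated (b :: L)) {i : ℕ}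
    (hi : i ∈ blocksUnion L) : i + 1 < b.1 := by
  obtain ⟨c, hc, h1, h2⟩ := hi
  have := (List.pairwise_cons.mp h.2).1 c hc
  omega

theorem exists_blocksSeparated (S : Finset ℕ) :
    ∃ L, BlocksSeparated L ∧ blocksUnion L = S := by
  induction S using Finset.induction_on_max with
  | empty => exact ⟨[], by simp [BlocksSeparated], by simp [blocksUnion]⟩
  | insert a S ha ih =>
    obtain ⟨L, hL, hS⟩ := ih
    rcases L with _ | ⟨b, R⟩
    · refine ⟨[(a, 1)], by simp [BlocksSeparated], ?_⟩
      have : S = ∅ := by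
        rw [← Finset.coe_eq_empty, ← hS]
        simp [blocksUnion]
      ext i
      simp [blocksUnion, this]
      omega
    · have hb := hL.1 b (by simp)
      have hlast : b.1 + b.2 - 1 ∈ S := by
        rw [← Finset.mem_coe, ← hS, mem_blocksUnion_cons]
        left; omega
      have hle := ha _ hlast
      have hmem (i : ℕ) : i ∈ S ↔ (b.1 ≤ i ∧ i < b.1 + b.2) ∨ i ∈ blocksUnion R := by
        rw [← Finset.mem_coe, ← hS, mem_blocksUnion_cons]
      -- The new maximum either extends the top block or starts a block of its own.
      by_cases hab : b.1 + b.2 = a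
      · refine ⟨(b.1, b.2 + 1) :: R, ⟨?_, ?_⟩, ?_⟩
        · intro c hc
          rcases List.mem_cons.mp hc with rfl | hc
          · simp
          · exact hL.1 c (List.mem_cons_of_mem _ hc)
        · exact List.pairwise_cons.mpr (List.pairwise_cons.mp hL.2)
        · ext i
          rw [mem_blocksUnion_cons, Finset.mem_coe, Finset.mem_insert, hmem]
          dsimp only
          constructor
          · rintro (h | h)
            · omega
            · exact Or.inr (Or.inr h)
          · rintro (h | h | h)
            · omega
            · omega
            · exact Or.inr h
      · refine ⟨(a, 1) :: b :: R, ⟨?_, ?_⟩, ?_⟩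
        · intro c hc
          rcases List.mem_cons.mp hc with rfl | hc
          · simp
          · exact hL.1 c hc
        · refine List.pairwise_cons.mpr ⟨fun c hc => ?_, hL.2⟩
          rcases List.mem_cons.mp hc with rfl | hc
          · dsimp only; omega
          · have := (List.pairwise_cons.mp hL.2).1 c hc
            dsimp only; omega
        · ext i
          rw [mem_blocksUnion_cons, hS, Finset.mem_coe, Finset.mem_coe, Finset.mem_insert]
          refine or_congr_left ?_
          dsimp only
          omega

/-- The block `b` lies above all others, with a gap. Its image starts at `d`, again past a gap, so
no adjacency is created or lost. -/
theorem IsPinEmbedding.cons {s s' : ℕ → Bool} {L : List (ℕ × ℕ)} {b : ℕ × ℕ} {g : ℕ → ℕ}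
    (hg : IsPinEmbedding s s' (blocksUnion L) g) (hL : BlocksSeparated (b :: L)) {d : ℕ}
    (hd : ∀ i ∈ blocksUnion L, g i + 1 < d)
    (htype : ∀ e < b.2, pinType s' (d + e) = pinType s (b.1 + e)) :
    ∃ g', IsPinEmbedding s s' (blocksUnion (b :: L)) g' ∧ (∀ i ∈ blocksUnion L, g' i = g i) ∧
      ∀ e, g' (b.1 + e) = d + e := by
  have hlow (i : ℕ) (hi : i ∈ blocksUnion L) : ¬ b.1 ≤ i := by
    have := hL.lt hi
    omega
  refine ⟨fun i => if b.1 ≤ i then d + (i - b.1) else g i, ⟨?_, ?_, ?_⟩, ?_, ?_⟩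
  · intro i hi
    rcases mem_blocksUnion_cons.mp hi with hi | hi
    · rw [if_pos hi.1, htype _ (by omega)]
      congr 1; omega
    · rw [if_neg (hlow i hi), hg.pinType_eq i hi]
  · intro i hi j hj hij
    rcases mem_blocksUnion_cons.mp hi with hi | hi <;> rcases mem_blocksUnion_cons.mp hj with hj | hj
    · rw [if_pos hi.1, if_pos hj.1]; omega
    · have := hlow j hj
      omega
    · rw [if_neg (hlow i hi), if_pos hj.1]
      have := hd i hi
      omega
    · rw [if_neg (hlow i hi), if_neg (hlow j hj)]
      exact hg.lt i hi j hj hij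
  · intro i hi j hj hij
    rcases mem_blocksUnion_cons.mp hi with hi | hi <;> rcases mem_blocksUnion_cons.mp hj with hj | hj
    · rw [if_pos hi.1, if_pos hj.1]; omega
    · have := hlow j hj
      omega
    · rw [if_neg (hlow i hi), if_pos hj.1]
      have := hd i hi
      have := hL.lt hi
      omega
    · rw [if_neg (hlow i hi), if_neg (hlow j hj)]
      exact hg.succ_iff i hi j hj hij
  · intro i hi
    exact if_neg (hlow i hi)
  · intro e
    simp

theorem isPinEmbedding_nil (s s' : ℕ → Bool) (g : ℕ → ℕ) :
    IsPinEmbedding s s' (blocksUnion []) g := by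
  constructor <;> simp [blocksUnion]

/-- If every block recurs arbitrarily far out in another pin sequence, then the blocks embed
together. -/
theorem exists_isPinEmbedding {s s' : ℕ → Bool} {L : List (ℕ × ℕ)} (hL : BlocksSeparated L)
    (h : ∀ b ∈ L, ∀ N, ∃ d ≥ N, ∀ e < b.2, pinType s' (d + e) = pinType s (b.1 + e)) :
    ∃ g, IsPinEmbedding s s' (blocksUnion L) g := by
  suffices ∃ g, IsPinEmbedding s s' (blocksUnion L) g ∧ ∃ M, ∀ i ∈ blocksUnion L, g i < M from
    this.imp fun _ => And.left
  induction L with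
  | nil => exact ⟨id, isPinEmbedding_nil _ _ _, 0, by simp [blocksUnion]⟩
  | cons b L ih =>
    obtain ⟨g, hg, M, hM⟩ := ih hL.tail fun c hc => h c (List.mem_cons_of_mem _ hc)
    obtain ⟨d, hd, htype⟩ := h b (by simp) (M + 1)
    obtain ⟨g', hg', hrest, hblock⟩ := hg.cons hL
      (fun i hi => by have := hM i hi; omega) htype
    refine ⟨g', hg', d + b.2, fun i hi => ?_⟩
    rcases mem_blocksUnion_cons.mp hi with hi | hi
    · obtain ⟨e, rfl⟩ := Nat.exists_eq_add_of_le hi.1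
      rw [hblock]
      omega
    · rw [hrest i hi]
      have := hM i hi
      omega

/-! ### Well-quasi-order -/

/-- The first block occurs inside the second one. -/
def BlockLE (s : ℕ → Bool) (b c : ℕ × ℕ) : Prop :=
  ∃ d, c.1 ≤ d ∧ d + b.2 ≤ c.1 + c.2 ∧ ∀ e < b.2, pinType s (d + e) = pinType s (b.1 + e)

instance (s : ℕ → Bool) : IsPreorder (ℕ × ℕ) (BlockLE s) where
  refl b := ⟨b.1, le_rfl, le_rfl, fun _ _ => rfl⟩
  trans := by
    rintro a b c ⟨d, h1, h2, h3⟩ ⟨d', h1', h2', h3'⟩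
    refine ⟨d' + (d - b.1), by omega, by omega, fun e he => ?_⟩
    rw [add_assoc, h3' _ (by omega), ← h3 e he]
    congr 1
    omega

/-- Images chosen inside separated blocks are themselves separated, so Higman's order on block lists
yields an embedding. -/
theorem exists_isPinEmbedding_of_sublistForall₂ {s : ℕ → Bool} {L L' : List (ℕ × ℕ)}
    (hL : BlocksSeparated L) (hL' : BlocksSeparated L') (h : List.SublistForall₂ (BlockLE s) L L') :
    ∃ g, IsPinEmbedding s s (blocksUnion L) g ∧ ∀ i ∈ blocksUnion L, g i ∈ blocksUnion L' := by
  induction h with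
  | nil => exact ⟨id, isPinEmbedding_nil _ _ _, by simp [blocksUnion]⟩
  | cons hbc _ ih =>
    obtain ⟨g, hg, hgL⟩ := ih hL.tail hL'.tail
    obtain ⟨d, h1, h2, h3⟩ := hbc
    obtain ⟨g', hg', hrest, hblock⟩ := hg.cons hL
      (fun i hi => by have := hL'.lt (hgL i hi); omega) h3
    refine ⟨g', hg', fun i hi => ?_⟩
    rw [mem_blocksUnion_cons]
    rcases mem_blocksUnion_cons.mp hi with hi | hi
    · obtain ⟨e, rfl⟩ := Nat.exists_eq_add_of_le hi.1
      rw [hblock]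
      omega
    · rw [hrest i hi]
      exact Or.inr (hgL i hi)
  | cons_right _ ih =>
    obtain ⟨g, hg, hgL⟩ := ih hL hL'.tail
    exact ⟨g, hg, fun i hi => mem_blocksUnion_cons.mpr (Or.inr (hgL i hi))⟩

theorem pinType_window {s s' : ℕ → Bool} {a d : ℕ} {n : ℕ}
    (h : ∀ e < n / 2 + 1, s' (d + e) = s (a / 2 + e)) :
    ∀ e < n, pinType s' (2 * d + a % 2 + e) = pinType s (a + e) := by
  intro e he
  rw [pinType_eq_iff]
  refine ⟨by omega, ?_⟩
  have := h ((a % 2 + e) / 2) (by omega)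
  rwa [show d + (a % 2 + e) / 2 = (2 * d + a % 2 + e) / 2 by omega,
    show a / 2 + (a % 2 + e) / 2 = (a + e) / 2 by omega] at this

theorem UniformlyRecurrent.pinType {s : ℕ → Bool} (hs : UniformlyRecurrent s) :
    UniformlyRecurrent (pinType s) := by
  intro a n
  obtain ⟨R, hR⟩ := hs (a / 2) (n / 2 + 1)
  refine ⟨2 * R + 4, fun b => ?_⟩
  obtain ⟨d, h1, h2, h3⟩ := hR (b / 2 + 1)
  exact ⟨2 * d + a % 2, by omega, by omega, pinType_window h3⟩

/-- By uniform recurrence, any block of length at least `R` contains a copy of the block `f 0`. If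
no later block is that long, only finitely many contents are possible and one repeats. -/
theorem wellQuasiOrdered_blockLE {s : ℕ → Bool} (hs : UniformlyRecurrent s) :
    WellQuasiOrdered (BlockLE s) := by
  intro f
  obtain ⟨R, hR⟩ := hs.pinType (f 0).1 (f 0).2
  by_cases h : ∃ j, 0 < j ∧ R ≤ (f j).2
  · obtain ⟨j, hj, hRj⟩ := h
    obtain ⟨d, h1, h2, h3⟩ := hR (f j).1
    exact ⟨0, j, hj, d, h1, by omega, h3⟩
  · push Not at h
    -- The index is shifted because `f 0` itself need not be shorter than `R`.
    let F (j : ℕ) : Fin R × (Fin R → Bool × Bool) :=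
      (⟨(f (j + 1)).2, h _ (by omega)⟩, fun e => pinType s ((f (j + 1)).1 + e))
    obtain ⟨i, j, hij, hF⟩ := Finite.exists_ne_map_eq_of_infinite F
    wlog hlt : i < j generalizing i j
    · exact this j i hij.symm hF.symm (by omega)
    refine ⟨i + 1, j + 1, by omega, (f (j + 1)).1, le_rfl, ?_, fun e he => ?_⟩
    · have := congrArg (fun x => (x.1 : ℕ)) hF
      simp only [F] at this
      omega
    · exact (congrFun (congrArg Prod.snd hF) ⟨e, he.trans (h _ (by omega))⟩).symm

theorem isWQO_pinClass {s : ℕ → Bool} (hs : UniformlyRecurrent s) : (pinClass s).IsWQO := by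
  intro A hA hanti
  by_contra hinf
  have hinf : A.Infinite := hinf
  let σ (n : ℕ) : Permutation := hinf.natEmbedding A n
  have hσA (n : ℕ) : σ n ∈ A := (hinf.natEmbedding A n).2
  have hrep (n : ℕ) : ∃ p, PinRealizes s (σ n) p := mem_pinClass.mp (hA (hσA n))
  choose p hp using hrep
  have hblocks (n : ℕ) := exists_blocksSeparated (Finset.univ.image (p n))
  choose L hL hLS using hblocks
  have hLS' (n : ℕ) : blocksUnion (L n) = Set.range (p n) := by simp [hLS]
  have hpwo : (Set.univ : Set (ℕ × ℕ)).PartiallyWellOrderedOn (BlockLE s) := by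
    intro f
    exact wellQuasiOrdered_blockLE hs fun n => (f n).1
  obtain ⟨m, n, hmn, hle⟩ := hpwo.partiallyWellOrderedOn_sublistForall₂ (BlockLE s)
    fun n => ⟨L n, fun _ _ => trivial⟩
  obtain ⟨g, hg, hgL⟩ := exists_isPinEmbedding_of_sublistForall₂ (hL m) (hL n) hle
  simp only [hLS'] at hg hgL
  have hcomp := (hp m).comp hg fun i => Set.mem_range_self i
  have : σ m ≤ σ n := hcomp.le (hp n) fun i => hgL _ (Set.mem_range_self i)
  refine hanti (hσA m) (hσA n) (fun h => ?_) this
  exact hmn.ne ((hinf.natEmbedding A).injective (Subtype.ext h))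

/-! ### Countability of algebraic and D-finite series -/

open scoped RatFunc

instance Polynomial.instCountable {R : Type*} [Semiring R] [Countable R] : Countable R[X] := by
  have h : Function.Injective fun p : R[X] => p.toFinsupp.coeff := fun p q h => by
    ext n
    exact DFunLike.congr_fun h n
  exact h.countable

theorem Set.countable_setOf_isAlgebraicSeries : {f : ℚ⟦X⟧ | IsAlgebraicSeries f}.Countable := by
  have : Module.IsTorsionFree ℚ[X] ℚ⟦X⟧ := by
    rw [Module.isTorsionFree_iff_algebraMap_injective]
    intro p q h
    refine Polynomial.coe_injective ℚ ?_
    simpa [PowerSeries.algebraMap_apply'] using h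
  exact Algebraic.countable ℚ[X] ℚ⟦X⟧

namespace PowerSeries

theorem coeff_X_pow_mul_iterate_derivative (f : ℚ⟦X⟧) (k n : ℕ) :
    coeff n ((X : ℚ⟦X⟧) ^ k * (derivative ℚ)^[k] f) = n.descFactorial k * coeff n f := by
  rw [coeff_X_pow_mul']
  split_ifs with h
  · obtain ⟨m, rfl⟩ := Nat.exists_eq_add_of_le' h
    rw [Nat.add_sub_cancel]
    rw [coeff_iterate_derivative, Nat.add_descFactorial_eq_ascFactorial]
  · rw [Nat.descFactorial_of_lt (by omega)]
    simp

/-- A nonzero formal power series solution of a linear differential equation with polynomial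
coefficients has one of finitely many orders. -/
theorem exists_finset_order_mem {g : ℕ →₀ ℚ[X]} (hg : g ≠ 0) :
    ∃ S : Finset ℕ, ∀ f : ℚ⟦X⟧, (g.sum fun k p => (p : ℚ⟦X⟧) * (derivative ℚ)^[k] f) = 0 →
      (∀ d ∈ S, coeff d f = 0) → f = 0 := by
  -- Multiplying the equation by `X ^ r` turns each derivative into the operator `X ^ k * D ^ k`,
  -- which is diagonal on monomials, with coefficient `g k * X ^ (r - k)`. Below, `μ` is the lowest
  -- degree occurring in these coefficients.
  set r := g.support.sup id
  have hr : ∀ k ∈ g.support, k ≤ r := fun k hk => Finset.le_sup (f := id) hk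
  have hex : ∃ m, ∃ k ∈ g.support, (g k * Polynomial.X ^ (r - k)).coeff m ≠ 0 := by
    obtain ⟨k, hk⟩ := Finsupp.support_nonempty_iff.mpr hg
    have : g k * Polynomial.X ^ (r - k) ≠ 0 :=
      mul_ne_zero (Finsupp.mem_support_iff.mp hk) (pow_ne_zero _ Polynomial.X_ne_zero)
    exact ⟨_, k, hk, mt Polynomial.leadingCoeff_eq_zero.mp this⟩
  classical
  set μ := Nat.find hex
  obtain ⟨k₀, hk₀, hμ⟩ := Nat.find_spec hex
  have hmin : ∀ k ∈ g.support, ∀ m < μ, (g k * Polynomial.X ^ (r - k)).coeff m = 0 := by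
    intro k hk m hm
    by_contra h
    exact Nat.find_min hex hm ⟨k, hk, h⟩
  -- The indicial polynomial: for `f` of order `d`, the coefficient of degree `μ + d` in the scaled
  -- equation is `Q(d)` times the leading coefficient of `f`.
  set Q : ℚ[X] := ∑ k ∈ g.support,
    Polynomial.C ((g k * Polynomial.X ^ (r - k)).coeff μ) * descPochhammer ℚ k with hQdef
  have hQeval (d : ℕ) : Q.eval (d : ℚ) =
      ∑ k ∈ g.support, (g k * Polynomial.X ^ (r - k)).coeff μ * (d.descFactorial k : ℚ) := by
    simp [hQdef, Polynomial.eval_finsetSum, descPochhammer_eval_eq_descFactorial]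
  have hQ : Q ≠ 0 := by
    intro h0
    -- Falling factorials are triangular: at `k`, terms above `k` vanish, terms below vanish by
    -- induction, and `k!` times the `k`-th coefficient remains.
    have hzero : ∀ k ∈ g.support, (g k * Polynomial.X ^ (r - k)).coeff μ = 0 := by
      intro k
      induction k using Nat.strong_induction_on with
      | _ k ih =>
        intro hk
        have h1 := hQeval k
        rw [h0, Polynomial.eval_zero, Finset.sum_eq_single k] at h1
        · simpa [Nat.descFactorial_self, Nat.factorial_ne_zero] using h1.symm
        · intro l hl hlk
          rcases lt_or_gt_of_ne hlk with h | h
          · rw [ih l h hl, zero_mul]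
          · rw [Nat.descFactorial_of_lt h, Nat.cast_zero, mul_zero]
        · exact fun h => absurd hk h
    exact hμ (hzero k₀ hk₀)
  refine ⟨Q.roots.toFinset.preimage (fun n : ℕ => (n : ℚ)) (Nat.cast_injective.injOn),
    fun f hf hS => ?_⟩
  by_contra hne
  set d := f.order.toNat with hd
  have hlow (n : ℕ) (hn : n < d) : coeff n f = 0 := coeff_of_lt_order_toNat n hn
  have hdne : coeff d f ≠ 0 := coeff_order hne
  have hroot : Q.eval (d : ℚ) = 0 := by
    have h1 : ∑ k ∈ g.support, ((g k * Polynomial.X ^ (r - k) : ℚ[X]) : ℚ⟦X⟧) *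
        (X ^ k * (derivative ℚ)^[k] f) = 0 := by
      have h2 := congrArg (fun F => (X : ℚ⟦X⟧) ^ r * F) hf
      simp only [mul_zero, Finsupp.sum, Finset.mul_sum] at h2
      rw [← h2]
      refine Finset.sum_congr rfl fun k hk => ?_
      obtain ⟨c, hc⟩ := Nat.exists_eq_add_of_le (hr k hk)
      rw [hc, Nat.add_sub_cancel_left]
      push_cast
      ring
    have h3 := congrArg (coeff (μ + d)) h1
    rw [map_sum, map_zero] at h3
    rw [hQeval, ← mul_right_cancel₀ (b := coeff d f) hdne (c := 0)]
    rw [zero_mul, ← h3, Finset.sum_mul]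
    refine Finset.sum_congr rfl fun k hk => ?_
    rw [coeff_mul, Finset.sum_eq_single (μ, d)]
    · simp only [coeff_X_pow_mul_iterate_derivative, Polynomial.coeff_coe, mul_assoc]
    · rintro ⟨i, j⟩ hij hne'
      rw [Finset.HasAntidiagonal.mem_antidiagonal] at hij
      simp only [coeff_X_pow_mul_iterate_derivative, Polynomial.coeff_coe]
      rcases lt_or_ge i μ with hi | hi
      · rw [hmin k hk i hi, zero_mul]
      · rw [hlow j, mul_zero, mul_zero]
        by_contra hj
        exact hne' (Prod.ext (by simp at hij ⊢; omega) (by simp at hij ⊢; omega))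
    · simp
  exact hdne (hS d (by simp [hQ, hroot]))

end PowerSeries

/-- There are countably many equations over `ℚ[X]`, and a solution of a given one is determined by
finitely many rational coefficients. -/
theorem Set.countable_setOf_isDFinite : {f : ℚ⟦X⟧ | IsDFinite f}.Countable := by
  have hsub : {f : ℚ⟦X⟧ | IsDFinite f} ⊆ ⋃ g ∈ {g : ℕ →₀ ℚ[X] | g ≠ 0},
      {f | (g.sum fun k p => (p : ℚ⟦X⟧) * (PowerSeries.derivative ℚ)^[k] f) = 0} := by
    intro f hf
    simp only [Set.mem_iUnion, Set.mem_ofPred_eq, exists_prop]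
    set v : ℕ → ℚ⸨X⸩ := fun k => (((PowerSeries.derivative ℚ)^[k] f : ℚ⟦X⟧) : ℚ⸨X⸩)
    have hli : ¬ LinearIndependent (RatFunc ℚ) v := by
      intro hli
      have hfin : Module.Finite (RatFunc ℚ) (Submodule.span (RatFunc ℚ) (Set.range v)) := hf
      exact (Module.Finite.finite_basis (Module.Basis.span hli)).false
    -- Denominators are cleared in the dependence relation.
    rw [← LinearIndependent.iff_fractionRing ℚ[X]] at hli
    rw [linearIndependent_iff] at hli
    push Not at hli
    obtain ⟨g, hg, hne⟩ := hli
    refine ⟨g, hne, ?_⟩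
    apply HahnSeries.ofPowerSeries_injective (Γ := ℤ) (R := ℚ)
    rw [Finsupp.linearCombination_apply] at hg
    rw [map_zero, ← hg, Finsupp.sum, Finsupp.sum, map_sum]
    refine Finset.sum_congr rfl fun k _ => ?_
    rw [map_mul, Algebra.smul_def]
    congr 1
  refine (Set.Countable.biUnion (Set.to_countable _) fun g hg => ?_).mono hsub
  obtain ⟨S, hS⟩ := PowerSeries.exists_finset_order_mem hg
  have hinj : Set.InjOn (fun (f : ℚ⟦X⟧) (d : S) => PowerSeries.coeff d f)
      {f | (g.sum fun k p => (p : ℚ⟦X⟧) * (PowerSeries.derivative ℚ)^[k] f) = 0} := by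
    intro f hf f' hf' h
    rw [← sub_eq_zero]
    refine hS _ ?_ fun d hd => ?_
    · simp only [iterate_map_sub, mul_sub, Finsupp.sum_sub]
      rw [hf, hf', sub_zero]
    · simpa [sub_eq_zero] using congrFun h ⟨d, hd⟩
  exact Set.MapsTo.countable_of_injOn (t := Set.univ) (fun _ _ => trivial) hinj (Set.to_countable _)

/-! ### Reading the word off a pin permutation -/

theorem abs_pinY (s : ℕ → Bool) (i : ℕ) : |pinY s i| = pinHeight i := by
  unfold pinY
  split_ifs <;> simp

theorem pinHeight_lt {i j : ℕ} (h : i < j) (h' : ¬ (i % 2 = 0 ∧ j = i + 1)) :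
    pinHeight i < pinHeight j := by
  unfold pinHeight
  split_ifs <;> omega

/-- If a point `E` lies vertically between `B` and the points `A`, `C`, and horizontally to the
right of all of them, then `B`, `E` is one of the pairs of the pin sequence. -/
theorem pin_pair_of_separates {s : ℕ → Bool} {b : Bool} {A B C D E : ℕ} (hAB : pinX A < pinX B)
    (hBC : pinX B < pinX C) (hCD : pinX C < pinX D) (hDE : pinX D < pinX E)
    (ht : b = true → pinY s A < pinY s E ∧ pinY s C < pinY s E ∧ pinY s E < pinY s B)
    (hf : b = false → pinY s E < pinY s A ∧ pinY s E < pinY s C ∧ pinY s B < pinY s E) :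
    B % 2 = 0 ∧ E = B + 1 ∧ s (B / 2) = b := by
  -- Abscissae reverse the index order only for neighbours at distance 1; the point `D` keeps `E`
  -- further away than that.
  have hlt : A < E ∧ B < E ∧ C < E := by
    unfold pinX at *
    split_ifs at * <;> omega
  have hne : A ≠ B ∧ A ≠ C ∧ B ≠ C := by
    refine ⟨?_, ?_, ?_⟩ <;> rintro rfl <;> omega
  have hA := abs_le.mp (abs_pinY s A).le
  have hB := abs_le.mp (abs_pinY s B).le
  have hC := abs_le.mp (abs_pinY s C).le
  have hE : pinY s E = if s (E / 2) then (pinHeight E : ℤ) else -pinHeight E := rfl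
  -- Otherwise `E` is further from the axis than `B` and than at least one of `A`, `C`, so it cannot
  -- lie vertically between them.
  have hpair : B % 2 = 0 ∧ E = B + 1 := by
    by_contra hnot
    have hBE := pinHeight_lt hlt.2.1 hnot
    by_cases hAE : A % 2 = 0 ∧ E = A + 1
    · have hCE := pinHeight_lt hlt.2.2 (by omega)
      cases b <;> simp only [reduceCtorEq, false_implies, true_implies] at ht hf <;>
        split_ifs at hE <;> omega
    · have hAE := pinHeight_lt hlt.1 hAE
      cases b <;> simp only [reduceCtorEq, false_implies, true_implies] at ht hf <;>
        split_ifs at hE <;> omega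
  refine ⟨hpair.1, hpair.2, ?_⟩
  have hBE : E / 2 = B / 2 := by omega
  unfold pinY pinHeight at ht hf
  rw [hBE, if_neg (by omega : ¬ E % 2 = 0), if_pos hpair.1] at ht hf
  cases hs : s (B / 2) <;> cases b <;> simp [hs] at ht hf ⊢ <;> omega

/-- A copy of a window of one pin sequence in another one forces a common window of the words. -/
theorem exists_window_of_pin_copy {s s' : ℕ → Bool} {a m : ℕ} (f : ℕ → ℕ)
    (hf : ∀ i j, 2 * a ≤ i → i < 2 * a + 2 * m → 2 * a ≤ j → j < 2 * a + 2 * m →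
      (pinX i < pinX j ↔ pinX (f i) < pinX (f j)) ∧
        (pinY s i < pinY s j ↔ pinY s' (f i) < pinY s' (f j))) :
    ∃ c, ∀ k, k + 2 < m → s' (c + k) = s (a + 1 + k) := by
  have key (k : ℕ) (hk : k + 2 < m) : f (2 * (a + 1 + k)) % 2 = 0 ∧
      f (2 * (a + 1 + k) + 1) = f (2 * (a + 1 + k)) + 1 ∧
      s' (f (2 * (a + 1 + k)) / 2) = s (a + 1 + k) := by
    have hxlt (i j : ℕ) (h1 : 2 * a ≤ i) (h2 : i < 2 * a + 2 * m) (h3 : 2 * a ≤ j)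
        (h4 : j < 2 * a + 2 * m) (h : pinX i < pinX j) := (hf i j h1 h2 h3 h4).1.mp h
    have hylt (i j : ℕ) (h1 : 2 * a ≤ i) (h2 : i < 2 * a + 2 * m) (h3 : 2 * a ≤ j)
        (h4 : j < 2 * a + 2 * m) (h : pinY s i < pinY s j) := (hf i j h1 h2 h3 h4).2.mp h
    have hq1 : (2 * (a + 1 + k) + 1) / 2 = a + 1 + k := by omega
    have hq2 : 2 * (a + 1 + k) / 2 = a + 1 + k := by omega
    -- `A` and `C` come from the preceding pair and `D` from the following one, which is why the
    -- first and last pairs of the window are lost.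
    refine pin_pair_of_separates (A := f (2 * (a + k))) (C := f (2 * (a + k) + 1))
      (D := f (2 * (a + k + 2))) ?_ ?_ ?_ ?_ ?_ ?_
    iterate 4
      refine hxlt _ _ (by omega) (by omega) (by omega) (by omega) ?_
      unfold pinX
      split_ifs <;> omega
    · intro hs
      refine ⟨?_, ?_, ?_⟩ <;>
      · refine hylt _ _ (by omega) (by omega) (by omega) (by omega) ?_
        unfold pinY pinHeight
        simp only [hq1, hq2, hs]
        split_ifs <;> omega
    · intro hs
      refine ⟨?_, ?_, ?_⟩ <;>
      · refine hylt _ _ (by omega) (by omega) (by omega) (by omega) ?_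
        unfold pinY pinHeight
        simp only [hq1, hq2, hs, Bool.false_eq_true, if_false]
        split_ifs <;> omega
  -- The image of each first point is even. Comparing abscissae puts the next one strictly between
  -- it and it plus 3, hence exactly 2 further.
  have hshift (k : ℕ) (hk : k + 2 < m) : f (2 * (a + 1 + k)) = f (2 * (a + 1)) + 2 * k := by
    induction k with
    | zero => simp
    | succ k ih =>
      have ih := ih (by omega)
      obtain ⟨h1, h2, -⟩ := key k (by omega)
      obtain ⟨h3, h4, -⟩ := key (k + 1) hk
      have hx1 := (hf (2 * (a + 1 + (k + 1))) (2 * (a + 1 + k) + 1) (by omega) (by omega) (by omega)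
        (by omega)).1.mp (by unfold pinX; split_ifs <;> omega)
      have hx2 := (hf (2 * (a + 1 + k) + 1) (2 * (a + 1 + (k + 1)) + 1) (by omega) (by omega)
        (by omega) (by omega)).1.mp (by unfold pinX; split_ifs <;> omega)
      rw [h2] at hx1 hx2
      rw [h4] at hx2
      unfold pinX at hx1 hx2
      split_ifs at hx1 hx2 <;> omega
  refine ⟨f (2 * (a + 1)) / 2, fun k hk => ?_⟩
  obtain ⟨h1, -, h3⟩ := key k hk
  rw [hshift k hk] at h1 h3
  rw [← h3]
  congr 1
  omega

/-- If all short windows of one word recur in another one, then short permutations of the first pin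
class belong to the second one. -/
theorem mem_pinClass_of_windows {s s' : ℕ → Bool} {σ : Permutation} (hσ : σ ∈ pinClass s')
    (h : ∀ a N, ∃ d ≥ N, ∀ e < σ.length / 2 + 1, s (d + e) = s' (a + e)) : σ ∈ pinClass s := by
  obtain ⟨p, hp⟩ := mem_pinClass.mp hσ
  obtain ⟨L, hL, hLS⟩ := exists_blocksSeparated (Finset.univ.image p)
  have hlen (b : ℕ × ℕ) (hb : b ∈ L) : b.2 ≤ σ.length := by
    have hsub : Finset.Ico b.1 (b.1 + b.2) ⊆ Finset.univ.image p := by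
      intro i hi
      rw [← Finset.mem_coe, ← hLS]
      exact ⟨b, hb, Finset.mem_Ico.mp hi⟩
    simpa using (Finset.card_le_card hsub).trans Finset.card_image_le
  obtain ⟨g, hg⟩ := exists_isPinEmbedding (s' := s) hL (s := s') (by
    intro b hb N
    obtain ⟨d, hd, hw⟩ := h (b.1 / 2) N
    refine ⟨2 * d + b.1 % 2, by omega, fun e he => ?_⟩
    exact pinType_window hw e (he.trans_le (hlen b hb)))
  refine ⟨_, hp.comp hg fun i => ?_⟩
  rw [hLS]
  simp

/-- A window of a word whose interior does not occur in another word yields a permutation that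
distinguishes the two pin classes. -/
theorem exists_mem_pinClass_not_mem {s s' : ℕ → Bool} {a m : ℕ}
    (h : ∀ c, ¬ ∀ k < m, s' (c + k) = s (a + 1 + k)) :
    ∃ σ : Equiv.Perm (Fin (2 * (m + 2))), (⟨_, σ⟩ : Permutation) ∈ pinClass s ∧
      (⟨_, σ⟩ : Permutation) ∉ pinClass s' := by
  have hcard : (Finset.Ico (2 * a) (2 * a + 2 * (m + 2))).card = 2 * (m + 2) := by simp
  obtain ⟨σ, p, hp, hrange⟩ := exists_pinRealizes s (Finset.Ico (2 * a) (2 * a + 2 * (m + 2)))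
  rw [← hcard]
  refine ⟨σ, ⟨p, hp⟩, ?_⟩
  rintro ⟨q, hq⟩
  -- `j` inverts `p` on the interval; its value elsewhere is irrelevant.
  have hinv (i : ℕ) : ∃ j, 2 * a ≤ i → i < 2 * a + 2 * (m + 2) → p j = i := by
    by_cases hi : i ∈ Set.range p
    · exact hi.imp fun _ hj _ _ => hj
    · have : 0 < (Finset.Ico (2 * a) (2 * a + 2 * (m + 2))).card := by simp
      refine ⟨⟨0, this⟩, fun h1 h2 => absurd ?_ hi⟩
      rw [hrange]
      simp; omega
  choose j hj using hinv
  obtain ⟨c, hc⟩ := exists_window_of_pin_copy (s := s) (s' := s') (a := a) (m := m + 2)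
    (fun i => q (j i)) (by
      intro i i' h1 h2 h3 h4
      have hpi := hp (j i) (j i')
      have hqi := hq (j i) (j i')
      rw [hj i h1 h2, hj i' h3 h4] at hpi
      exact ⟨hpi.1.symm.trans hqi.1, hpi.2.symm.trans hqi.2⟩)
  exact h c fun k hk => hc k (by omega)

/-! ### Uncountably many enumeration sequences -/

theorem PermutationClass.enumeration_lt {C D : PermutationClass} {n : ℕ}
    (hsub : ∀ σ : Equiv.Perm (Fin n), (⟨n, σ⟩ : Permutation) ∈ C → (⟨n, σ⟩ : Permutation) ∈ D)
    (hne : ∃ σ : Equiv.Perm (Fin n), (⟨n, σ⟩ : Permutation) ∈ D ∧ (⟨n, σ⟩ : Permutation) ∉ C) :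
    C.enumeration n < D.enumeration n := by
  obtain ⟨σ, hD, hC⟩ := hne
  refine Set.ncard_lt_ncard (s := {σ : Equiv.Perm (Fin n) | (⟨n, σ⟩ : Permutation) ∈ C})
    (t := {σ : Equiv.Perm (Fin n) | (⟨n, σ⟩ : Permutation) ∈ D}) ?_ (Set.toFinite _)
  exact ⟨hsub, fun h => hC (h hD)⟩

/-- At length `2 * (5 ^ k + 3)` the class of `t` strictly contains that of `t'`. Transferring
permutations of that length uses windows of length `5 ^ k + 4`, which is at most `2 * 5 ^ k` because
`k > 0`. -/
theorem enumeration_pinClass_toeplitz_ne {k : ℕ} (hk0 : 0 < k) {t t' : ℕ → Bool}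
    (htt' : ∀ i < k, t i = t' i) (hk : t k = true) (hk' : t' k = false) :
    (pinClass (toeplitz t')).enumeration ≠ (pinClass (toeplitz t)).enumeration := by
  have h5 : 5 ^ 1 ≤ 5 ^ k := Nat.pow_le_pow_right (by norm_num) hk0
  refine fun h => (PermutationClass.enumeration_lt (n := 2 * (5 ^ k + 1 + 2)) ?_ ?_).ne
    (congrFun h _)
  · intro σ hσ
    refine mem_pinClass_of_windows hσ fun a N => ?_
    exact exists_toeplitz_window htt' hk (by dsimp only; omega) N
  · refine exists_mem_pinClass_not_mem (a := 5 ^ k * 3 - 2) fun c hc => ?_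
    rw [show 5 ^ k * 3 - 2 + 1 = 5 ^ k * 3 - 1 by omega] at hc
    exact toeplitz_window_ne hk hk' c hc

/-- The word attached to an arbitrary binary sequence, whose first period pattern is fixed. -/
def toeplitzTail (u : ℕ → Bool) : ℕ → Bool := toeplitz fun i => Nat.casesOn i false u

theorem enumeration_pinClass_injective :
    Function.Injective fun u => (pinClass (toeplitzTail u)).enumeration := by
  intro u v huv
  by_contra hne
  have hex := Function.ne_iff.mp hne
  classical
  set k := Nat.find hex
  have hk : u k ≠ v k := Nat.find_spec hex
  have hlt (i : ℕ) (hi : i < k) : u i = v i := not_not.mp (Nat.find_min hex hi)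
  -- The prepended letter moves the first disagreement to `k + 1`, which is positive.
  have hlt' (i : ℕ) (hi : i < k + 1) :
      (Nat.casesOn i false u : Bool) = (Nat.casesOn i false v : Bool) := by
    rcases i with _ | i
    · rfl
    · exact hlt i (by omega)
  cases hu : u k with
  | true =>
    exact enumeration_pinClass_toeplitz_ne k.succ_pos hlt' hu (by simpa [hu] using hk.symm) huv.symm
  | false =>
    exact enumeration_pinClass_toeplitz_ne k.succ_pos (fun i hi => (hlt' i hi).symm)
      (by simpa [hu] using hk.symm) hu huv

theorem not_countable_range_of_injective {α : Type*} {F : (ℕ → Bool) → α}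
    (hF : Function.Injective F) : ¬ (Set.range F).Countable := by
  intro h
  have : Countable (ℕ → Bool) := by
    have := h.to_subtype
    exact (Set.rangeFactorization_injective.mpr hF).countable
  obtain ⟨e, he⟩ := this.exists_injective_nat
  classical
  refine Function.cantor_injective (fun S : Set ℕ => e fun n => decide (n ∈ S)) fun S T hST => ?_
  ext n
  simpa using congrFun (he hST) n

theorem exists_isWQO_genFun_notMem {S : Set ℚ⟦X⟧} (hS : S.Countable) :
    ∃ C : PermutationClass, C.IsWQO ∧ C.genFun ∉ S := by
  by_contra! h
  have hinj : Function.Injective fun u => (pinClass (toeplitzTail u)).genFun := by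
    intro u v huv
    refine enumeration_pinClass_injective (funext fun n => ?_)
    have := congrArg (PowerSeries.coeff n) huv
    simpa [PermutationClass.genFun] using this
  refine not_countable_range_of_injective hinj (hS.mono ?_)
  rintro _ ⟨u, rfl⟩
  exact h _ (isWQO_pinClass (uniformlyRecurrent_toeplitz _))

theorem theorem1p1 :
    (¬ {e : ℕ → ℕ | ∃ C : PermutationClass, C.IsWQO ∧ C.enumeration = e}.Countable) ∧
    (∃ C : PermutationClass, C.IsWQO ∧ ¬ IsAlgebraicSeries C.genFun) ∧
    (∃ C : PermutationClass, C.IsWQO ∧ ¬ IsDFinite C.genFun) ∧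
    (¬ ∀ C : PermutationClass, C.IsStronglyAlgebraic ↔ C.IsWQO) := by
  refine ⟨fun h => ?_, exists_isWQO_genFun_notMem Set.countable_setOf_isAlgebraicSeries,
    exists_isWQO_genFun_notMem Set.countable_setOf_isDFinite, fun h => ?_⟩
  · refine not_countable_range_of_injective enumeration_pinClass_injective (h.mono ?_)
    rintro _ ⟨u, rfl⟩
    exact ⟨_, isWQO_pinClass (uniformlyRecurrent_toeplitz _), rfl⟩
  · obtain ⟨C, hC, hna⟩ := exists_isWQO_genFun_notMem Set.countable_setOf_isAlgebraicSeries
    exact hna ((h C).mpr hC C le_rfl)
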